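/- **Gridded permutations.** All permutations are drawn in the plane gridded by the two coordinate axes: a gridded permutation of length $n$ is a permutation of length $n$, drawn as $n$ points off the axes with distinct abscissae and distinct ordinates, considered up to the relative order of the points and the quadrants that contain them. Containment of gridded permutations means that some of the points, in the same quadrants, have the same relative order. **Pin sequences.** A *pin sequence* is an infinite word $w=w_1w_2\cdots$ over the eight letters $\mathsf{l}_\mathsf{u},\mathsf{l}_\mathsf{d},\mathsf{r}_\mathsf{u},\mathsf{r}_\mathsf{d},\mathsf{u}_\mathsf{l},\mathsf{u}_\mathsf{r},\mathsf{d}_\mathsf{l},\mathsf{d}_\mathsf{r}$ (a direction left, right, up or down, with a perpendicular direction as subscript) in which the subscript of each $w_{i+1}$ is the direction of $w_i$. Its infinite gridded permutation $\pi_w$ has points $p_1,p_2,\dots$ placed as follows: $p_1$ lies in the quadrant given by the two directions of $w_1$; for $i\ge 1$ the point $p_{i+1}$ lies outside the rectangular hull of $\{(0,0),p_1,\dots,p_i\}$, in the direction of $w_{i+1}$, and its coordinate along the other axis lies strictly between that of $p_i$ and those of all of $(0,0),p_1,\dots,p_{i-1}$. The *pin class* $\mathcal{C}_w$ is the set of all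 finite gridded permutations contained in $\pi_w$, and $|(\mathcal{C}_w)_n|$ is the number of those of length $n$. **Growth rates.** Write $\mathrm{gr}(\mathcal{C}_w)=\lim_{n\to\infty}|(\mathcal{C}_w)_n|^{1/n}$ for the growth rate and $\underline{\mathrm{gr}}(\mathcal{C}_w)=\liminf_{n\to\infty}|(\mathcal{C}_w)_n|^{1/n}$ for the lower growth rate; the two agree whenever the limit exists. Let $\mu\approx 3.28277$ be the largest real zero of $z^5-4z^4+3z^3-2z^2-z+2$. **Binary sequences.** For an infinite binary sequence $b$ let $\phi(b)$ be the pin sequence obtained from $b$ by replacing each $0$ by $\mathsf{l}_\mathsf{u}\mathsf{u}_\mathsf{l}$ and each $1$ by $\mathsf{r}_\mathsf{u}\mathsf{u}_\mathsf{r}$. The sequence $b$ is *eventually periodic* if there are $N\ge 0$ and $k\ge 1$ with $b_{i+k}=b_i$ for all $i>N$. **Lemma.** Let $b$ be an infinite binary sequence. If $\underline{\mathrm{gr}}(\mathcal{C}_{\phi(b)})<\mu$ (in particular, if $\mathrm{gr}(\mathcal{C}_{\phi(b)})<\mu$), then $b$ is eventually periodic. -/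

import Mathlib

open scoped ENNReal

noncomputable section

namespace PinClass

/-! ### Words -/

/-- An infinite word is periodic if `w (i + k) = w i` for all `i`, for some positive `k`. -/
def Periodic {α : Type*} (w : ℕ → α) : Prop :=
  ∃ k : ℕ, 0 < k ∧ ∀ i : ℕ, w (i + k) = w i

/-- An infinite word is eventually periodic if deleting some finite prefix leaves a periodic
word. -/
def EventuallyPeriodic {α : Type*} (w : ℕ → α) : Prop :=
  ∃ N : ℕ, Periodic (fun i => w (N + i))

/-! ### Pin words in the memory encoding -/

/-- The four directions of a pin. -/
inductive Dir : Type
  | left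
  | right
  | up
  | down

/-- How far the point `q` extends from the origin in direction `d` (a signed quantity). -/
def Dir.extent : Dir → ℤ × ℤ → ℤ
  | .left, q => -q.1
  | .right, q => q.1
  | .up, q => q.2
  | .down, q => -q.2

/-- The unit vector in a given direction. -/
def Dir.vec : Dir → ℤ × ℤ
  | .left => (-1, 0)
  | .right => (1, 0)
  | .up => (0, 1)
  | .down => (0, -1)

/-- The eight letters of the memory encoding. The letter `ru`, for example, stands for a right
pin that follows an up pin (and, as first letter, for a point in the quadrant to the right of and
above the origin that is followed by an up or down pin). -/
inductive Letter : Type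
  | lu
  | ld
  | ru
  | rd
  | ul
  | ur
  | dl
  | dr

/-- The direction of the pin encoded by a letter. -/
def Letter.dir : Letter → Dir
  | .lu => .left
  | .ld => .left
  | .ru => .right
  | .rd => .right
  | .ul => .up
  | .ur => .up
  | .dl => .down
  | .dr => .down

/-- The direction of the previous pin, as recorded in a letter. -/
def Letter.prev : Letter → Dir
  | .lu => .up
  | .ld => .down
  | .ru => .up
  | .rd => .down
  | .ul => .left
  | .ur => .right
  | .dl => .left
  | .dr => .right

/-- A pin sequence: an infinite word over the eight letters in which each letter correctly
records the direction of its predecessor. -/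
structure PinSequence : Type where
  letter : ℕ → Letter
  prev_eq : ∀ i : ℕ, (letter (i + 1)).prev = (letter i).dir

/-! ### The infinite gridded permutation of a pin sequence -/

/-- The points `p 0, p 1, …` are placed according to the pin sequence `w`, in the plane gridded by
the two coordinate axes: the first point lies in the quadrant given by the first letter, and each
later point lies outside the rectangular hull of the origin and all earlier points, in the
direction given by its letter, and separates its predecessor from the origin and all the points
before the predecessor. -/
structure IsPinPlacement (w : PinSequence) (p : ℕ → ℤ × ℤ) : Prop where
  first_dir : 0 < (w.letter 0).dir.extent (p 0)
  first_prev : 0 < (w.letter 0).prev.extent (p 0)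
  outside_origin : ∀ i : ℕ, 0 < (w.letter (i + 1)).dir.extent (p (i + 1))
  outside : ∀ i j : ℕ, j ≤ i →
    (w.letter (i + 1)).dir.extent (p j) < (w.letter (i + 1)).dir.extent (p (i + 1))
  beyond_origin : ∀ i : ℕ, 0 < (w.letter (i + 1)).prev.extent (p (i + 1))
  beyond : ∀ i j : ℕ, j < i →
    (w.letter (i + 1)).prev.extent (p j) < (w.letter (i + 1)).prev.extent (p (i + 1))
  before_pred : ∀ i : ℕ,
    (w.letter (i + 1)).prev.extent (p (i + 1)) < (w.letter (i + 1)).prev.extent (p i)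

/-- Explicit points realising the pin sequence `w`: the `i`-th point (counted from `0`) is at
distance `2 i + 4` in its own direction and at distance `2 i + 1` in the direction of its
predecessor, that is, just short of the predecessor, which is at distance `2 i + 2`. -/
def pinPoint (w : PinSequence) (i : ℕ) : ℤ × ℤ :=
  (2 * (i : ℤ) + 4) • (w.letter i).dir.vec + (2 * (i : ℤ) + 1) • (w.letter i).prev.vec

theorem extent_dir_pinPoint (w : PinSequence) (i : ℕ) :
    (w.letter i).dir.extent (pinPoint w i) = 2 * (i : ℤ) + 4 := by
  unfold pinPoint
  cases w.letter i <;> simp [Letter.dir, Letter.prev, Dir.vec, Dir.extent]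

theorem extent_prev_pinPoint (w : PinSequence) (i : ℕ) :
    (w.letter i).prev.extent (pinPoint w i) = 2 * (i : ℤ) + 1 := by
  unfold pinPoint
  cases w.letter i <;> simp [Letter.dir, Letter.prev, Dir.vec, Dir.extent]

theorem extent_pinPoint_le (w : PinSequence) (i : ℕ) (d : Dir) :
    d.extent (pinPoint w i) ≤ 2 * (i : ℤ) + 4 := by
  unfold pinPoint
  cases w.letter i <;> cases d <;> simp [Letter.dir, Letter.prev, Dir.vec, Dir.extent] <;> omega

/-- The explicit points are indeed placed according to the pin sequence. -/
theorem isPinPlacement_pinPoint (w : PinSequence) : IsPinPlacement w (pinPoint w) where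
  first_dir := by rw [extent_dir_pinPoint]; omega
  first_prev := by rw [extent_prev_pinPoint]; omega
  outside_origin i := by rw [extent_dir_pinPoint]; omega
  outside i j h := by
    have := extent_pinPoint_le w j (w.letter (i + 1)).dir
    rw [extent_dir_pinPoint]; push_cast; omega
  beyond_origin i := by rw [extent_prev_pinPoint]; omega
  beyond i j h := by
    have := extent_pinPoint_le w j (w.letter (i + 1)).prev
    rw [extent_prev_pinPoint]; push_cast; omega
  before_pred i := by
    rw [extent_prev_pinPoint, w.prev_eq, extent_dir_pinPoint]; push_cast; omega

/-! ### Gridded permutations and pin classes -/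

/-- A permutation of length `n`, drawn as the points `(i, perm i)`, in the plane gridded by one
vertical line with exactly `vert` points to its left and one horizontal line with exactly `horiz`
points below it. (Two griddings of a permutation are equal when corresponding cells contain the
same points, so they are determined by these two numbers.) -/
@[ext]
structure GriddedPerm (n : ℕ) : Type where
  perm : Equiv.Perm (Fin n)
  vert : Fin (n + 1)
  horiz : Fin (n + 1)

instance (n : ℕ) : Finite (GriddedPerm n) :=
  Finite.of_injective
    (fun σ : GriddedPerm n => (σ.perm, σ.vert, σ.horiz))
    (fun σ τ h => by
      simp only [Prod.mk.injEq] at h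
      exact GriddedPerm.ext h.1 h.2.1 h.2.2)

/-- The gridded permutation `σ` is contained in the family of points `p`, where the plane is
gridded by the two coordinate axes: some points of the family, injectively chosen, are in the same
relative order as the points of `σ` and lie in the same cells. -/
def GriddedPerm.ContainedIn {n : ℕ} (σ : GriddedPerm n) (p : ℕ → ℤ × ℤ) : Prop :=
  ∃ f : Fin n → ℕ, Function.Injective f ∧
    (∀ i j : Fin n, i < j ↔ (p (f i)).1 < (p (f j)).1) ∧
    (∀ i j : Fin n, σ.perm i < σ.perm j ↔ (p (f i)).2 < (p (f j)).2) ∧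
    (∀ i : Fin n, (i : ℕ) < (σ.vert : ℕ) ↔ (p (f i)).1 < 0) ∧
    (∀ i : Fin n, (σ.perm i : ℕ) < (σ.horiz : ℕ) ↔ (p (f i)).2 < 0)

/-- The members of length `n` of the pin class of `w`. -/
def pinClass (w : PinSequence) (n : ℕ) : Set (GriddedPerm n) :=
  {σ | σ.ContainedIn (pinPoint w)}

/-! ### Growth rates -/

/-- The growth rate of the sequence `s` is `g`. -/
def HasGrowthRate (s : ℕ → ℕ) (g : ℝ) : Prop :=
  Filter.Tendsto (fun n : ℕ => (s n : ℝ) ^ (1 / (n : ℝ))) Filter.atTop (nhds g)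

/-- The lower growth rate of the sequence `s`, an extended non-negative real number. -/
def lowerGrowthRate (s : ℕ → ℕ) : ℝ≥0∞ :=
  Filter.liminf (fun n : ℕ => (s n : ℝ≥0∞) ^ (1 / (n : ℝ))) Filter.atTop

/-- Where the growth rate exists, it is the lower growth rate. -/
theorem HasGrowthRate.lowerGrowthRate_eq {s : ℕ → ℕ} {g : ℝ} (h : HasGrowthRate s g) :
    lowerGrowthRate s = ENNReal.ofReal g := by
  refine Filter.Tendsto.liminf_eq ?_
  refine (ENNReal.tendsto_ofReal h).congr fun n => ?_
  rw [← ENNReal.ofReal_rpow_of_nonneg (Nat.cast_nonneg _) (by positivity),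
    ENNReal.ofReal_natCast]

/-- The largest real zero of `z ^ 5 - 4 z ^ 4 + 3 z ^ 3 - 2 z ^ 2 - z + 2`. -/
def mu : ℝ := sSup {z : ℝ | z ^ 5 - 4 * z ^ 4 + 3 * z ^ 3 - 2 * z ^ 2 - z + 2 = 0}

theorem isGreatest_mu :
    IsGreatest {z : ℝ | z ^ 5 - 4 * z ^ 4 + 3 * z ^ 3 - 2 * z ^ 2 - z + 2 = 0} mu := by
  have hb : BddAbove {z : ℝ | z ^ 5 - 4 * z ^ 4 + 3 * z ^ 3 - 2 * z ^ 2 - z + 2 = 0} := by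
    refine ⟨4, fun z hz => ?_⟩
    change z ^ 5 - 4 * z ^ 4 + 3 * z ^ 3 - 2 * z ^ 2 - z + 2 = 0 at hz
    by_contra! h
    have h1 : 0 < z ^ 4 * (z - 4) := by have : 0 < z - 4 := by linarith
                                        positivity
    nlinarith [mul_pos (show 0 < z - 4 by linarith) (show 0 < z - 4 by linarith),
      mul_pos (show 0 < z - 4 by linarith) (show 0 < z ^ 2 by positivity)]
  have hc : Continuous fun z : ℝ => z ^ 5 - 4 * z ^ 4 + 3 * z ^ 3 - 2 * z ^ 2 - z + 2 := by
    fun_prop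
  have hn : {z : ℝ | z ^ 5 - 4 * z ^ 4 + 3 * z ^ 3 - 2 * z ^ 2 - z + 2 = 0}.Nonempty := by
    obtain ⟨z, -, hz⟩ := intermediate_value_Icc (show (3 : ℝ) ≤ 4 by norm_num) hc.continuousOn
      (show (0 : ℝ) ∈ Set.Icc _ _ by constructor <;> norm_num)
    exact ⟨z, hz⟩
  exact ⟨(isClosed_eq hc continuous_const).csSup_mem hn hb, fun z hz => le_csSup hb hz⟩

/-! ### Pin sequences from binary sequences -/

/-- The letters of the image under `φ` of the binary sequence `b` (with `false` for `0` and `true`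
for `1`): each `0` is replaced by `lu ul` and each `1` by `ru ur`. -/
def phiLetter (b : ℕ → Bool) (i : ℕ) : Letter :=
  match b (i / 2), decide (i % 2 = 0) with
  | false, true => .lu
  | false, false => .ul
  | true, true => .ru
  | true, false => .ur

/-- The pin sequence `φ(b)`, in the first two quadrants. -/
def phi (b : ℕ → Bool) : PinSequence where
  letter := phiLetter b
  prev_eq i := by
    obtain ⟨k, rfl | rfl⟩ := Nat.even_or_odd' i
    · have h1 : (2 * k + 1) / 2 = k := by omega
      have h2 : (2 * k) / 2 = k := by omega
      simp only [phiLetter, h1, h2]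
      cases b k <;> simp [Letter.prev, Letter.dir, Nat.add_mod]
    · have h1 : (2 * k + 1 + 1) / 2 = k + 1 := by omega
      have h2 : (2 * k + 1) / 2 = k := by omega
      have h3 : (2 * k + 1 + 1) % 2 = 0 := by omega
      simp only [phiLetter, h1, h2, h3]
      cases b k <;> cases b (k + 1) <;> simp [Letter.prev, Letter.dir, Nat.add_mod]

end PinClass

end

namespace PinClass

/-! All points of `φ(b)` lie above the horizontal axis. Listed by height, a set of them has a code:
the side of each point, and the pairs on one side whose lower point is farther out. The gridded
permutation determines the code, so counting codes bounds the class from below. Linked points have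
ranks differing by 1 or 3 (`linked_iff`), so codes that occur arbitrarily late can be joined freely.
A join determines its indecomposable first part, whence `sum_ncard_le`: with `L n` late codes and `I
m` indecomposable ones, the sum of `I m * L (n - m)` over `1 ≤ m ≤ n` is at most `L n`.

If `b` is not eventually periodic, a Morse–Hedlund argument gives at least `k + 1` recurring factors
of each length `k`. Runs of consecutive pins, starting at either parity, turn these into at least 2,
2, 4 and then `m + 3` indecomposable codes of size `m` (`indecomposableBound_le`). The generating
function of these bounds takes the value 1 at `1 / mu`, an equation that is the reversal of the one
defining `mu`; the recursive inequality then forces lower growth at least `mu`. -/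

/-! ### Points by height -/

/-- The index of the point of rank `q` when the points of `φ(b)` are sorted by height; valid for
positive `q`. -/
def rankIndex (q : ℕ) : ℕ := if q % 2 = 1 then q + 1 else q - 1

/-- The position in `b` of the symbol that gives the side of the point of rank `q`. -/
def block (q : ℕ) : ℕ := if q % 2 = 1 then (q + 1) / 2 else q / 2 - 1

/-- The abscissa of the point of rank `q`. -/
def rankX (b : ℕ → Bool) (q : ℕ) : ℤ :=
  if b (block q) then (if q % 2 = 1 then 2 * (q : ℤ) + 6 else 2 * (q : ℤ) - 1)
  else -(if q % 2 = 1 then 2 * (q : ℤ) + 6 else 2 * (q : ℤ) - 1)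

/-- The ordinate of the point of rank `q`. -/
def rankY (q : ℕ) : ℤ := if q % 2 = 1 then 2 * (q : ℤ) + 3 else 2 * (q : ℤ) + 2

/-- Counting pins from 0, pin `2k + 2` has height `4k + 5`, just below pin `2k + 1` at `4k + 6`;
this is the swap in `rankIndex`. Pin 0 is lowest and is left out. -/
theorem pinPoint_rankIndex (b : ℕ → Bool) {q : ℕ} (hq : 0 < q) :
    pinPoint (phi b) (rankIndex q) = (rankX b q, rankY q) := by
  obtain ⟨k, rfl | rfl⟩ : ∃ k, q = 2 * k + 1 ∨ q = 2 * k + 2 := ⟨(q - 1) / 2, by omega⟩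
  · have h1 : rankIndex (2 * k + 1) = 2 * k + 2 := by unfold rankIndex; split_ifs <;> omega
    have h2 : block (2 * k + 1) = k + 1 := by unfold block; split_ifs <;> omega
    have h3 : (2 * k + 2) / 2 = k + 1 := by omega
    have h4 : (2 * k + 1) % 2 = 1 := by omega
    have h5 : (2 * k + 2) % 2 = 0 := by omega
    simp only [h1, pinPoint, phi, phiLetter, rankX, rankY, h2, h3, h4, h5]
    cases b (k + 1) <;> simp [Letter.dir, Letter.prev, Dir.vec] <;> ring_nf <;> trivial
  · have h1 : rankIndex (2 * k + 2) = 2 * k + 1 := by unfold rankIndex; split_ifs <;> omega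
    have h2 : block (2 * k + 2) = k := by unfold block; split_ifs <;> omega
    have h3 : (2 * k + 1) / 2 = k := by omega
    have h4 : (2 * k + 1) % 2 = 1 := by omega
    have h5 : (2 * k + 2) % 2 = 0 := by omega
    simp only [h1, pinPoint, phi, phiLetter, rankX, rankY, h2, h3, h4, h5]
    cases b k <;> simp [Letter.dir, Letter.prev, Dir.vec] <;> ring_nf <;> trivial

theorem rankX_neg_iff (b : ℕ → Bool) {q : ℕ} (hq : 0 < q) :
    rankX b q < 0 ↔ b (block q) = false := by
  unfold rankX
  cases b (block q) <;> simp <;> split_ifs <;> omega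

theorem rankX_injective (b : ℕ → Bool) {q q' : ℕ} (hq : 0 < q) (hq' : 0 < q')
    (h : rankX b q = rankX b q') : q = q' := by
  unfold rankX at h
  split_ifs at h <;> omega

theorem rankY_strictMono : StrictMono rankY := by
  intro q q' h
  unfold rankY
  split_ifs <;> omega

theorem rankY_pos (q : ℕ) : 0 < rankY q := by
  unfold rankY
  split_ifs <;> omega

/-! ### Patterns -/

/-- For ranks `q < q'`: the points lie on the same side, and the lower one is farther from the
vertical axis. -/
def Linked (b : ℕ → Bool) (q q' : ℕ) : Prop :=
  q % 2 = 1 ∧ (q' = q + 1 ∧ b (block q) = b (block q') ∨ q' = q + 3)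

/-- Odd ranks lie at distance `2q + 6` from the vertical axis, even ranks at `2q - 1`. So only an
odd `q` can be farther out than a later `q'`, and then `q'` is `q + 1` or `q + 3`. Ranks `q` and `q
+ 3` belong to the same symbol of `b`, hence to the same side. -/
theorem linked_iff (b : ℕ → Bool) {q q' : ℕ} (hq : 0 < q) (h : q < q') :
    Linked b q q' ↔ rankX b q < rankX b q' ∧ rankX b q' < 0 ∨
      rankX b q' < rankX b q ∧ ¬ rankX b q' < 0 := by
  have hb : q' = q + 3 → q % 2 = 1 → block q = block q' := by
    rintro rfl h; unfold block; split_ifs <;> omega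
  rw [rankX_neg_iff b (hq.trans h)]
  unfold Linked rankX
  rcases Nat.mod_two_eq_zero_or_one q with h1 | h1 <;>
  rcases Nat.mod_two_eq_zero_or_one q' with h2 | h2 <;>
  cases hu : b (block q) <;> cases hv : b (block q') <;>
  simp only [h1, h2] <;> simp <;> try omega
  all_goals
    have hne : q' ≠ q + 3 := fun h3 => by
      rw [hb h3 h1, hv] at hu
      exact Bool.noConfusion hu
    omega

/-- The relation recording, for points with abscissae `X 0, …, X (n - 1)` listed by height, which
of them lie to the left (on the diagonal), and which pairs on the same side are such that the
lower point is farther out (above the diagonal). -/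
def code (n : ℕ) (X : ℕ → ℤ) (r s : ℕ) : Prop :=
  r ≤ s ∧ s < n ∧ (r = s ∧ X r < 0 ∨
    r ≠ s ∧ (X r < X s ∧ X s < 0 ∨ X s < X r ∧ ¬ X s < 0))

/-- The code of the points of ranks `e 0, …, e (n - 1)` of `φ(b)`. -/
def pattern (b : ℕ → Bool) (n : ℕ) (e : ℕ → ℕ) (r s : ℕ) : Prop :=
  r ≤ s ∧ s < n ∧ (r = s ∧ b (block (e r)) = false ∨ r ≠ s ∧ Linked b (e r) (e s))

theorem pattern_eq_code (b : ℕ → Bool) (n : ℕ) {e : ℕ → ℕ} (he : StrictMono e) (h0 : 0 < e 0) :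
    pattern b n e = code n (fun r => rankX b (e r)) := by
  have hp : ∀ r, 0 < e r := fun r => h0.trans_le (he.monotone (Nat.zero_le r))
  funext r s
  refine propext (and_congr_right fun hrs => and_congr_right fun _ => or_congr ?_ ?_)
  · rw [rankX_neg_iff b (hp r)]
  · exact and_congr_right fun hne => linked_iff b (hp r) (he (lt_of_le_of_ne hrs hne))

theorem code_congr {n : ℕ} {X X' : ℕ → ℤ} (h0 : ∀ r < n, X r < 0 ↔ X' r < 0)
    (h : ∀ r < n, ∀ s < n, X r < X s ↔ X' r < X' s) : code n X = code n X' := by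
  funext r s
  refine propext (and_congr_right fun hrs => and_congr_right fun hs => ?_)
  rw [h0 r (hrs.trans_lt hs), h0 s hs, h r (hrs.trans_lt hs) s hs, h s hs r (hrs.trans_lt hs)]

/-- The abscissa of the point of height rank `r` in a drawing of `σ`. -/
def GriddedPerm.coord {n : ℕ} (σ : GriddedPerm n) (r : ℕ) : ℤ :=
  -- The value is odd, so it is never 0 and its sign tells the side.
  if h : r < n then 2 * ((σ.perm.symm ⟨r, h⟩ : ℕ) : ℤ) + 1 - 2 * ((σ.vert : ℕ) : ℤ) else 0

theorem exists_cut {n : ℕ} (P : Fin n → Prop) (hP : ∀ i j, i ≤ j → P j → P i) :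
    ∃ v : Fin (n + 1), ∀ i : Fin n, (i : ℕ) < (v : ℕ) ↔ P i := by
  classical
  refine ⟨⟨(Finset.univ.filter P).card, ?_⟩, fun i => ⟨fun h => ?_, fun h => ?_⟩⟩
  · have := Finset.card_le_univ (Finset.univ.filter P)
    rw [Fintype.card_fin] at this
    omega
  · by_contra hi
    have : Finset.univ.filter P ⊆ Finset.Iio i := fun j hj => by
      rw [Finset.mem_Iio]
      by_contra hij
      exact hi (hP i j (not_lt.1 hij) (Finset.mem_filter.1 hj).2)
    have := Finset.card_le_card this
    rw [Fin.card_Iio] at this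
    exact absurd h (not_lt.2 this)
  · have : Finset.Iic i ⊆ Finset.univ.filter P := fun j hj =>
      Finset.mem_filter.2 ⟨Finset.mem_univ _, hP j i (Finset.mem_Iic.1 hj) h⟩
    have := Finset.card_le_card this
    rw [Fin.card_Iic] at this
    exact this

theorem exists_mem_pinClass (b : ℕ → Bool) (n : ℕ) {e : ℕ → ℕ} (he : StrictMono e)
    (h0 : 0 < e 0) : ∃ σ ∈ pinClass (phi b) n, code n σ.coord = pattern b n e := by
  have hp : ∀ r, 0 < e r := fun r => h0.trans_le (he.monotone (Nat.zero_le r))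
  set X : Fin n → ℤ := fun r => rankX b (e r) with hX
  have hinj : Function.Injective X := fun r s h =>
    Fin.ext (he.injective (rankX_injective b (hp r) (hp s) h))
  set π := Tuple.sort X with hπ
  have hmono : StrictMono (X ∘ π) :=
    (Tuple.monotone_sort X).strictMono_of_injective (hinj.comp π.injective)
  obtain ⟨v, hv⟩ := exists_cut (fun i : Fin n => X (π i) < 0)
    (fun i j hij hj => (hmono.monotone hij).trans_lt hj)
  -- Sorting by abscissa gives the permutation; the last `0` says that no point lies below the
  -- horizontal axis.
  refine ⟨⟨π, v, 0⟩, ⟨fun i => rankIndex (e (π i)), ?_, ?_, ?_, ?_, ?_⟩, ?_⟩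
  · intro i j hij
    have := pinPoint_rankIndex b (hp (π i))
    simp only at hij
    rw [hij, pinPoint_rankIndex b (hp (π j)), Prod.mk.injEq] at this
    exact (hinj.comp π.injective) this.1.symm
  · intro i j
    simp only [pinPoint_rankIndex b (hp _)]
    exact hmono.lt_iff_lt.symm
  · intro i j
    simp only [pinPoint_rankIndex b (hp _)]
    rw [rankY_strictMono.lt_iff_lt, he.lt_iff_lt, Fin.lt_def]
  · intro i
    simp only [pinPoint_rankIndex b (hp _)]
    exact hv i
  · intro i
    simp only [pinPoint_rankIndex b (hp _)]
    have := rankY_pos (e (π i))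
    simp [this.le]
  · rw [pattern_eq_code b n he h0]
    have key : ∀ r (hr : r < n), X (π (π.symm ⟨r, hr⟩)) = rankX b (e r) := fun r hr => by simp [hX]
    refine code_congr (fun r hr => ?_) (fun r hr s hs => ?_)
    · have := hv (π.symm ⟨r, hr⟩)
      rw [key] at this
      simp only [GriddedPerm.coord, hr, dite_true]
      rw [← this]
      omega
    · have := hmono.lt_iff_lt (a := π.symm ⟨r, hr⟩) (b := π.symm ⟨s, hs⟩)
      simp only [Function.comp, key] at this
      rw [this, Fin.lt_def]
      simp only [GriddedPerm.coord, hr, hs, dite_true]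
      omega

/-! ### Patterns that occur arbitrarily late -/

/-- The codes of size `n` of points of `φ(b)` that occur arbitrarily late. -/
def latePatterns (b : ℕ → Bool) (n : ℕ) : Set (ℕ → ℕ → Prop) :=
  {c | ∀ N : ℕ, ∃ e : ℕ → ℕ, StrictMono e ∧ N ≤ e 0 ∧ pattern b n e = c}

theorem exists_injOn_latePatterns (b : ℕ → Bool) (n : ℕ) :
    ∃ F : (ℕ → ℕ → Prop) → GriddedPerm n,
      Set.MapsTo F (latePatterns b n) (pinClass (phi b) n) ∧ Set.InjOn F (latePatterns b n) := by
  have : ∀ c, ∃ σ : GriddedPerm n, c ∈ latePatterns b n →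
      σ ∈ pinClass (phi b) n ∧ code n σ.coord = c := by
    intro c
    by_cases hc : c ∈ latePatterns b n
    · obtain ⟨e, he, h1, rfl⟩ := hc 1
      obtain ⟨σ, hσ⟩ := exists_mem_pinClass b n he h1
      exact ⟨σ, fun _ => hσ⟩
    · exact ⟨⟨1, 0, 0⟩, fun h => absurd h hc⟩
  choose F hF using this
  refine ⟨F, fun c hc => (hF c hc).1, fun c hc d hd h => ?_⟩
  rw [← (hF c hc).2, h, (hF d hd).2]

theorem finite_latePatterns (b : ℕ → Bool) (n : ℕ) : (latePatterns b n).Finite := by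
  obtain ⟨F, hF, hinj⟩ := exists_injOn_latePatterns b n
  exact Set.Finite.of_injOn hF hinj (Set.toFinite _)

theorem ncard_latePatterns_le (b : ℕ → Bool) (n : ℕ) :
    (latePatterns b n).ncard ≤ (pinClass (phi b) n).ncard := by
  obtain ⟨F, hF, hinj⟩ := exists_injOn_latePatterns b n
  exact Set.ncard_le_ncard_of_injOn F hF hinj (Set.toFinite _)

/-! ### Joins and unique decomposition. -/

/-- Every horizontal cut through the `m` points separates two points related by `c`. -/
def Indecomposable (m : ℕ) (c : ℕ → ℕ → Prop) : Prop :=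
  ∀ t, 0 < t → t < m → ∃ r < t, ∃ s, t ≤ s ∧ c r s

/-- The code of a set of `m` points followed by points farther out. -/
def join (m : ℕ) (c d : ℕ → ℕ → Prop) (r s : ℕ) : Prop :=
  c r s ∨ m ≤ r ∧ m ≤ s ∧ d (r - m) (s - m)

theorem join_mem_latePatterns {b : ℕ → Bool} {m n : ℕ} {c d : ℕ → ℕ → Prop}
    (hc : c ∈ latePatterns b m) (hd : d ∈ latePatterns b n) :
    join m c d ∈ latePatterns b (m + n) := by
  intro N
  obtain ⟨e, he, hN, rfl⟩ := hc N
  -- Links span at most 3 ranks, so a margin of 4 leaves the two parts unlinked.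
  obtain ⟨e', he', hN', rfl⟩ := hd (e m + 4)
  have hlate : ∀ r s, r < m → e r + 4 < e' s := fun r s hr => by
    have := he hr
    have := he'.monotone (Nat.zero_le s)
    omega
  refine ⟨fun r => if r < m then e r else e' (r - m), ?_, ?_, ?_⟩
  · intro r s hrs
    dsimp only
    split_ifs with h1 h2 h2
    · exact he hrs
    · have := hlate r (s - m) h1
      omega
    · omega
    · exact he' (by omega)
  · dsimp only
    split_ifs with h1
    · exact hN
    · have := he.monotone (Nat.zero_le m)
      have := he'.monotone (Nat.zero_le (0 - m))
      omega
  · funext r s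
    apply propext
    unfold join pattern
    by_cases hs : s < m
    · by_cases hr : r < m
      · simp only [hr, hs, if_true, not_le.2 hr, false_and, or_false]
        exact and_congr_right fun _ => and_congr_left fun _ => by simp; omega
      · constructor
        · intro h; omega
        · intro h; omega
    · by_cases hr : r < m
      · simp only [hr, hs, if_true, if_false, not_le.2 hr, false_and, or_false, and_false,
          iff_false]
        rintro ⟨-, -, h | h⟩
        · omega
        · have := hlate r (s - m) hr
          have := h.2
          unfold Linked at this
          omega
      · simp only [hr, hs, if_false, false_and, and_false, false_or, not_lt.1 hr, not_lt.1 hs,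
          true_and]
        have h1 : r ≤ s ↔ r - m ≤ s - m := by omega
        have h2 : s < m + n ↔ s - m < n := by omega
        have h3 : r = s ↔ r - m = s - m := by omega
        rw [h1, h2, ne_eq, h3]

theorem lt_of_mem_latePatterns {b : ℕ → Bool} {n : ℕ} {c : ℕ → ℕ → Prop}
    (hc : c ∈ latePatterns b n) {r s : ℕ} (h : c r s) : s < n := by
  obtain ⟨e, -, -, rfl⟩ := hc 0
  exact h.2.1

/-- If `m < m'`, the cut at `m` would be crossed by `c'`, but no pair of `join m c d` crosses it. -/
theorem le_of_join_eq {b : ℕ → Bool} {m m' : ℕ} {c c' d d' : ℕ → ℕ → Prop}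
    (hc : c ∈ latePatterns b m) (hm : 0 < m) (hi : Indecomposable m' c')
    (h : join m c d = join m' c' d') : m' ≤ m := by
  by_contra! hlt
  obtain ⟨r, hr, s, hs, hrs⟩ := hi m hm hlt
  have : join m c d r s := by rw [h]; exact Or.inl hrs
  rcases this with h1 | h1
  · have := lt_of_mem_latePatterns hc h1
    omega
  · omega

theorem eq_of_join_eq {b : ℕ → Bool} {m : ℕ} {c c' d d' : ℕ → ℕ → Prop}
    (hc : c ∈ latePatterns b m) (hc' : c' ∈ latePatterns b m)
    (h : join m c d = join m c' d') : c = c' ∧ d = d' := by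
  have h' : ∀ r s, join m c d r s ↔ join m c' d' r s := fun r s => by rw [h]
  constructor
  · funext r s
    apply propext
    have := h' r s
    unfold join at this
    have h1 := @lt_of_mem_latePatterns _ _ _ hc r s
    have h2 := @lt_of_mem_latePatterns _ _ _ hc' r s
    constructor <;> intro h3
    · rcases this.1 (Or.inl h3) with h4 | h4
      · exact h4
      · have := h1 h3; omega
    · rcases this.2 (Or.inl h3) with h4 | h4
      · exact h4
      · have := h2 h3; omega
  · funext r s
    apply propext
    have := h' (r + m) (s + m)
    unfold join at this
    have h1 := @lt_of_mem_latePatterns _ _ _ hc (r + m) (s + m)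
    have h2 := @lt_of_mem_latePatterns _ _ _ hc' (r + m) (s + m)
    simp only [Nat.add_sub_cancel, Nat.le_add_left, true_and] at this
    constructor <;> intro h3
    · rcases this.1 (Or.inr h3) with h4 | h4
      · have := h2 h4; omega
      · exact h4
    · rcases this.2 (Or.inr h3) with h4 | h4
      · have := h1 h4; omega
      · exact h4

/-- The indecomposable codes of size `m` that occur arbitrarily late. -/
def lateIndecomposables (b : ℕ → Bool) (m : ℕ) : Set (ℕ → ℕ → Prop) :=
  {c | c ∈ latePatterns b m ∧ Indecomposable m c}

theorem finite_lateIndecomposables (b : ℕ → Bool) (m : ℕ) : (lateIndecomposables b m).Finite :=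
  (finite_latePatterns b m).subset fun _ h => h.1

theorem sum_ncard_le (b : ℕ → Bool) (n : ℕ) :
    ∑ m ∈ Finset.Icc 1 n, (lateIndecomposables b m).ncard * (latePatterns b (n - m)).ncard ≤
      (latePatterns b n).ncard := by
  classical
  have e1 : ∀ m, (lateIndecomposables b m).ncard * (latePatterns b (n - m)).ncard =
      ((finite_lateIndecomposables b m).toFinset ×ˢ
        (finite_latePatterns b (n - m)).toFinset).card := fun m => by
    rw [Finset.card_product, Set.ncard_eq_toFinset_card _ (finite_lateIndecomposables b m),
      Set.ncard_eq_toFinset_card _ (finite_latePatterns b (n - m))]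
  rw [Finset.sum_congr rfl fun m _ => e1 m, ← Finset.card_sigma,
    Set.ncard_eq_toFinset_card _ (finite_latePatterns b n)]
  refine Finset.card_le_card_of_injOn (fun x => join x.1 x.2.1 x.2.2) ?_ ?_
  · rintro ⟨m, c, d⟩ h
    simp only [Finset.coe_sigma, Set.mem_sigma_iff, Finset.coe_Icc, Set.mem_Icc, Finset.coe_product,
      Set.mem_prod, Set.Finite.coe_toFinset] at h ⊢
    have := join_mem_latePatterns h.2.1.1 h.2.2
    rwa [show m + (n - m) = n by omega] at this
  · rintro ⟨m, c, d⟩ h ⟨m', c', d'⟩ h' heq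
    simp only [Finset.coe_sigma, Set.mem_sigma_iff, Finset.coe_Icc, Set.mem_Icc, Finset.coe_product,
      Set.mem_prod, Set.Finite.coe_toFinset] at h h' heq
    obtain rfl : m = m' := le_antisymm
      (le_of_join_eq h'.2.1.1 (by omega) h.2.1.2 heq.symm)
      (le_of_join_eq h.2.1.1 (by omega) h'.2.1.2 heq)
    obtain ⟨rfl, rfl⟩ := eq_of_join_eq h.2.1.1 h'.2.1.1 heq
    rfl

end PinClass
namespace PinClass

/-! ### Factors that occur infinitely often -/

/-- The factors of length `k` that occur infinitely often in `b`. -/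
def lateFactors (b : ℕ → Bool) (k : ℕ) : Set (Fin k → Bool) :=
  {u | ∃ᶠ i in Filter.atTop, ∀ j : Fin k, b (i + j) = u j}

theorem eventually_mem_lateFactors (b : ℕ → Bool) (k : ℕ) :
    ∀ᶠ i in Filter.atTop, (fun j : Fin k => b (i + j)) ∈ lateFactors b k := by
  have : ∀ u : Fin k → Bool, ∀ᶠ i in Filter.atTop,
      (∀ j : Fin k, b (i + j) = u j) → u ∈ lateFactors b k := by
    intro u
    by_cases hu : u ∈ lateFactors b k
    · exact Filter.Eventually.of_forall fun _ _ => hu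
    · exact (Filter.not_frequently.1 hu).mono fun i hi h => absurd h hi
  filter_upwards [Filter.eventually_all.2 this] with i hi
  exact hi _ fun _ => rfl

theorem image_lateFactors (b : ℕ → Bool) (k : ℕ) :
    (fun (u : Fin (k + 1) → Bool) (j : Fin k) => u j.castSucc) '' lateFactors b (k + 1) =
      lateFactors b k := by
  apply Set.Subset.antisymm
  · rintro _ ⟨u, hu, rfl⟩
    exact Filter.Frequently.mono hu fun i hi j => hi j.castSucc
  · intro u hu
    obtain ⟨i, hi, hmem⟩ :=
      (Filter.Frequently.and_eventually hu (eventually_mem_lateFactors b (k + 1))).exists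
    exact ⟨_, hmem, funext fun j => hi j⟩

/-- The Morse–Hedlund argument, for recurring factors: if their number does not grow, each has a
unique right extension, and a repeated window repeats forever. -/
theorem eventuallyPeriodic_of_ncard_le (b : ℕ → Bool) (k : ℕ)
    (h : (lateFactors b (k + 1)).ncard ≤ (lateFactors b k).ncard) : EventuallyPeriodic b := by
  rw [← image_lateFactors b k] at h
  -- Dropping the last letter is onto, so the count makes it injective.
  have hinj := (Set.ncard_image_iff (Set.toFinite (lateFactors b (k + 1)))).1
    (le_antisymm (Set.ncard_image_le (Set.toFinite _)) h)
  obtain ⟨N, hN⟩ := Filter.eventually_atTop.1 (eventually_mem_lateFactors b (k + 1))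
  have step : ∀ i i', N ≤ i → N ≤ i' → (∀ j < k, b (i + j) = b (i' + j)) →
      b (i + k) = b (i' + k) := by
    intro i i' hi hi' hw
    have := hinj (hN i hi) (hN i' hi') (funext fun j => hw j j.2)
    exact congrFun this (Fin.last k)
  obtain ⟨x, y, hxy, hw⟩ := Finite.exists_ne_map_eq_of_infinite
    (fun (i : ℕ) (j : Fin k) => b (N + i + j))
  wlog hlt : x < y generalizing x y
  · exact this y x hxy.symm hw.symm (by omega)
  have hw' : ∀ t, ∀ j < k, b (N + x + t + j) = b (N + y + t + j) := by
    intro t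
    induction t with
    | zero => exact fun j hj => congrFun hw ⟨j, hj⟩
    | succ t ih =>
      intro j hj
      have hs := step (N + x + t) (N + y + t) (by omega) (by omega) ih
      rcases Nat.lt_or_ge (j + 1) k with h1 | h1
      · have := ih (j + 1) h1
        rwa [show N + x + t + (j + 1) = N + x + (t + 1) + j by omega,
          show N + y + t + (j + 1) = N + y + (t + 1) + j by omega] at this
      · obtain rfl : k = j + 1 := by omega
        rwa [show N + x + t + (j + 1) = N + x + (t + 1) + j by omega,
          show N + y + t + (j + 1) = N + y + (t + 1) + j by omega] at hs
  -- The start is shifted by `k` because `step` compares the letters that follow the equal windows.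
  refine ⟨N + x + k, y - x, by omega, fun i => ?_⟩
  have := step (N + x + i) (N + y + i) (by omega) (by omega) (hw' i)
  dsimp only
  rw [show N + x + k + (i + (y - x)) = N + y + i + k by omega,
    show N + x + k + i = N + x + i + k by omega, this]

theorem lt_ncard_lateFactors {b : ℕ → Bool} (hb : ¬ EventuallyPeriodic b) (k : ℕ) :
    k < (lateFactors b k).ncard := by
  induction k with
  | zero =>
    rw [Set.ncard_pos (Set.toFinite _)]
    exact (eventually_mem_lateFactors b 0).exists.imp' _ fun _ h => h
  | succ k ih =>
    have := mt (eventuallyPeriodic_of_ncard_le b k) hb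
    omega

end PinClass
namespace PinClass

/-! ### Growth -/

/-- The lower bound for the number of indecomposable codes of each size. -/
def indecomposableBound (m : ℕ) : ℕ :=
  if m = 1 then 2 else if m = 2 then 2 else if m = 3 then 4 else m + 3

theorem three_le_mu : 3 ≤ mu := by
  have hc : Continuous fun z : ℝ => z ^ 5 - 4 * z ^ 4 + 3 * z ^ 3 - 2 * z ^ 2 - z + 2 := by
    fun_prop
  obtain ⟨z, hz, h0⟩ := intermediate_value_Icc (show (3 : ℝ) ≤ 4 by norm_num) hc.continuousOn
    (show (0 : ℝ) ∈ Set.Icc _ _ by constructor <;> norm_num)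
  exact hz.1.trans (isGreatest_mu.2 h0)

theorem sum_indecomposableBound (x : ℝ) (M : ℕ) :
    (1 - x) ^ 2 * ∑ m ∈ Finset.Icc 1 (M + 4), (indecomposableBound m : ℝ) * x ^ m =
      2 * x - 2 * x ^ 2 + 2 * x ^ 3 + x ^ 4 - 2 * x ^ 5 -
        x ^ (M + 5) * ((M + 8) - (M + 7) * x) := by
  induction M with
  | zero =>
    simp [Finset.sum_Icc_succ_top, indecomposableBound]
    ring
  | succ M ih =>
    rw [show M + 1 + 4 = M + 4 + 1 by omega, Finset.sum_Icc_succ_top (by omega), mul_add, ih]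
    simp [indecomposableBound]
    ring

/-- The full series is 1 at `1 / mu`. At the larger point `l⁻¹` the term `m = 1` alone gains `2 *
(l⁻¹ - x)`, more than a late enough tail loses. -/
theorem exists_one_le_sum {l : ℝ} (h1 : 1 < l) (hl : l < mu) :
    ∃ M : ℕ, 1 ≤ ∑ m ∈ Finset.Icc 1 M, (indecomposableBound m : ℝ) * l⁻¹ ^ m := by
  have hmu := three_le_mu
  set x := mu⁻¹ with hx
  have hx0 : 0 < x := by positivity
  have hx1 : x < 1 := inv_lt_one_of_one_lt₀ (by linarith)
  have hxl : x < l⁻¹ := inv_strictAnti₀ (by linarith) hl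
  -- Multiplying the equation of `mu` by `x ^ 5` reverses it, since `mu * x = 1`.
  have hroot : 2 * x - 2 * x ^ 2 + 2 * x ^ 3 + x ^ 4 - 2 * x ^ 5 = (1 - x) ^ 2 := by
    have h : mu ^ 5 - 4 * mu ^ 4 + 3 * mu ^ 3 - 2 * mu ^ 2 - mu + 2 = 0 := isGreatest_mu.1
    have hm : mu * x = 1 := mul_inv_cancel₀ (by linarith)
    linear_combination (-x ^ 5) * h + ((mu * x) ^ 4 + (mu * x) ^ 3 + (mu * x) ^ 2 + mu * x + 1
      - 4 * x * ((mu * x) ^ 3 + (mu * x) ^ 2 + mu * x + 1)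
      + 3 * x ^ 2 * ((mu * x) ^ 2 + mu * x + 1) - 2 * x ^ 3 * (mu * x + 1) - x ^ 4) * hm
  have hlim : Filter.Tendsto (fun M : ℕ => x ^ (M + 5) * (((M : ℝ) + 8) - (M + 7) * x))
      Filter.atTop (nhds 0) := by
    have ha := tendsto_self_mul_const_pow_of_lt_one hx0.le hx1
    have hb := tendsto_pow_atTop_nhds_zero_of_lt_one hx0.le hx1
    have := (ha.const_mul (x ^ 5 * (1 - x))).add (hb.const_mul (x ^ 5 * (8 - 7 * x)))
    simp only [mul_zero, add_zero] at this
    refine this.congr fun M => ?_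
    ring
  have hδ : 0 < (1 - x) ^ 2 * (2 * (l⁻¹ - x)) := by
    have : 0 < 1 - x := by linarith
    have : 0 < l⁻¹ - x := by linarith
    positivity
  obtain ⟨M, hM⟩ := (hlim.eventually (gt_mem_nhds hδ)).exists
  refine ⟨M + 4, ?_⟩
  have hs := sum_indecomposableBound x M
  rw [hroot] at hs
  have hcmp : ∑ m ∈ Finset.Icc 1 (M + 4), (indecomposableBound m : ℝ) * x ^ m + 2 * (l⁻¹ - x) ≤
      ∑ m ∈ Finset.Icc 1 (M + 4), (indecomposableBound m : ℝ) * l⁻¹ ^ m := by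
    have hmem : 1 ∈ Finset.Icc 1 (M + 4) := by simp
    rw [← Finset.add_sum_erase _ _ hmem,
      ← Finset.add_sum_erase (Finset.Icc 1 (M + 4))
        (fun m => (indecomposableBound m : ℝ) * l⁻¹ ^ m) hmem]
    have : ∑ m ∈ (Finset.Icc 1 (M + 4)).erase 1, (indecomposableBound m : ℝ) * x ^ m ≤
        ∑ m ∈ (Finset.Icc 1 (M + 4)).erase 1, (indecomposableBound m : ℝ) * l⁻¹ ^ m :=
      Finset.sum_le_sum fun m _ => by gcongr
    simp only [indecomposableBound, if_true, pow_one] at this ⊢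
    push_cast at this ⊢
    linarith
  have : 0 < (1 - x) ^ 2 := by
    have : 0 < 1 - x := by linarith
    positivity
  nlinarith

theorem exists_pow_le {a k : ℕ → ℕ} (h0 : 0 < k 0) (ha : 0 < a 1)
    (hk : ∀ n, ∑ m ∈ Finset.Icc 1 n, a m * k (n - m) ≤ k n) {l : ℝ} (hl : 1 < l) {M : ℕ}
    (hM : 1 ≤ ∑ m ∈ Finset.Icc 1 M, (a m : ℝ) * l⁻¹ ^ m) (n : ℕ) :
    l⁻¹ ^ M * l ^ n ≤ k n := by
  have hl0 : 0 < l := by linarith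
  have hpos : ∀ n, 0 < k n := by
    intro n
    induction n with
    | zero => exact h0
    | succ n ih =>
      refine lt_of_lt_of_le ?_ (hk (n + 1))
      refine lt_of_lt_of_le ?_ (Finset.single_le_sum (fun _ _ => Nat.zero_le _)
        (show 1 ∈ Finset.Icc 1 (n + 1) by simp))
      exact Nat.mul_pos ha (by simpa using ih)
  induction n using Nat.strong_induction_on with
  | _ n ih =>
    rcases Nat.lt_or_ge n M with hn | hn
    · have h1 : (1 : ℝ) ≤ k n := by exact_mod_cast hpos n
      refine le_trans ?_ h1
      rw [inv_pow, inv_mul_le_one₀ (by positivity)]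
      exact pow_le_pow_right₀ hl.le hn.le
    · calc l⁻¹ ^ M * l ^ n ≤ (l⁻¹ ^ M * l ^ n) * ∑ m ∈ Finset.Icc 1 M, (a m : ℝ) * l⁻¹ ^ m :=
            le_mul_of_one_le_right (by positivity) hM
        _ = ∑ m ∈ Finset.Icc 1 M, (a m : ℝ) * (l⁻¹ ^ M * l ^ (n - m)) := by
            rw [Finset.mul_sum]
            refine Finset.sum_congr rfl fun m hm => ?_
            have : m ≤ n := (Finset.mem_Icc.1 hm).2.trans hn
            rw [pow_sub₀ l hl0.ne' this, inv_pow, inv_pow]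
            ring
        _ ≤ ∑ m ∈ Finset.Icc 1 M, (a m : ℝ) * k (n - m) := by
            refine Finset.sum_le_sum fun m hm => ?_
            have := ih (n - m) (by have := Finset.mem_Icc.1 hm; omega)
            gcongr
        _ ≤ ∑ m ∈ Finset.Icc 1 n, (a m : ℝ) * k (n - m) :=
            Finset.sum_le_sum_of_subset_of_nonneg (Finset.Icc_subset_Icc_right hn)
              fun _ _ _ => by positivity
        _ ≤ k n := by exact_mod_cast hk n

theorem le_lowerGrowthRate {s : ℕ → ℕ} {C l l' : ℝ} (hC : 0 < C) (hl' : 0 < l') (hl : l' < l)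
    (h : ∀ n, C * l ^ n ≤ s n) : ENNReal.ofReal l' ≤ lowerGrowthRate s := by
  refine Filter.le_liminf_of_le (by isBoundedDefault) ?_
  have hlim := tendsto_pow_atTop_atTop_of_one_lt ((one_lt_div hl').2 hl)
  filter_upwards [hlim.eventually_ge_atTop C⁻¹, Filter.eventually_gt_atTop 0] with n hn hn0
  have h1 : l' ^ n ≤ s n := by
    refine le_trans ?_ (h n)
    rw [div_pow, le_div_iff₀ (by positivity), inv_mul_le_iff₀ hC] at hn
    exact hn
  rw [one_div, ENNReal.le_rpow_inv_iff (by positivity), ENNReal.rpow_natCast,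
    ← ENNReal.ofReal_pow hl'.le, ← ENNReal.ofReal_natCast]
  exact ENNReal.ofReal_le_ofReal h1

theorem mu_le_lowerGrowthRate {s a k : ℕ → ℕ} (hs : ∀ n, k n ≤ s n) (h0 : 0 < k 0)
    (ha : ∀ m, 0 < m → indecomposableBound m ≤ a m)
    (hk : ∀ n, ∑ m ∈ Finset.Icc 1 n, a m * k (n - m) ≤ k n) :
    ENNReal.ofReal mu ≤ lowerGrowthRate s := by
  by_contra! hlt
  obtain ⟨q, hq1, hq2⟩ := ENNReal.lt_iff_exists_nnreal_btwn.1 hlt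
  have hmu := three_le_mu
  have hq3 : (q : ℝ) < mu := by
    rw [ENNReal.ofReal, ENNReal.coe_lt_coe] at hq2
    exact (Real.lt_toNNReal_iff_coe_lt).1 hq2
  -- The maximum with 1 provides `1 < l`; the later `l' < l` absorbs the constant `l⁻¹ ^ M`.
  obtain ⟨l, h1, h2⟩ := exists_between (max_lt hq3 (show (1 : ℝ) < mu by linarith))
  have hl1 : 1 < l := (le_max_right _ _).trans_lt h1
  obtain ⟨l', h3, h4⟩ := exists_between h1
  obtain ⟨M, hM⟩ := exists_one_le_sum hl1 h2
  have hk' : ∀ n, ∑ m ∈ Finset.Icc 1 n, indecomposableBound m * k (n - m) ≤ k n := fun n =>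
    (Finset.sum_le_sum fun m hm =>
      Nat.mul_le_mul_right _ (ha m (Finset.mem_Icc.1 hm).1)).trans (hk n)
  have := le_lowerGrowthRate (s := s) (C := l⁻¹ ^ M) (l := l) (l' := l') (by positivity)
    (by have := (le_max_right (q : ℝ) 1).trans_lt h3; linarith) h4 fun n =>
      (exists_pow_le h0 (by simp [indecomposableBound]) hk' hl1 hM n).trans
        (by exact_mod_cast hs n)
  have h5 : (q : ℝ≥0∞) < lowerGrowthRate s := by
    refine lt_of_lt_of_le ?_ this
    rw [← ENNReal.ofReal_coe_nnreal]
    exact (ENNReal.ofReal_lt_ofReal_iff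
      (by have := (le_max_right (q : ℝ) 1).trans_lt h3; linarith)).2
        ((le_max_left _ _).trans_lt h3)
  exact absurd hq1 (not_lt.2 h5.le)

end PinClass
namespace PinClass

/-! ### Codes of sets of consecutive points -/

/-- The ranks `2 i + 1, 2 i + 2, …`, omitting two of them, so that `g` and `l` are the first
positions after the gaps. -/
def segment (i g l r : ℕ) : ℕ :=
  2 * i + 1 + r + (if g ≤ r then 1 else 0) + (if l ≤ r then 1 else 0)

theorem segment_strictMono (i g l : ℕ) : StrictMono (segment i g l) := by
  intro r s h
  unfold segment
  split_ifs <;> omega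

theorem segment_eq (i g l r : ℕ) : segment i g l r = 2 * i + segment 0 g l r := by
  unfold segment
  omega

theorem segment_pos (i g l r : ℕ) : 0 < segment i g l r := by
  unfold segment
  omega

theorem block_add (i : ℕ) {q : ℕ} (hq : 0 < q) : block (2 * i + q) = i + block q := by
  unfold block
  split_ifs <;> omega

/-- The word `u`, written from position `o` on. -/
def extend (o : ℕ) {k : ℕ} (u : Fin k → Bool) (x : ℕ) : Bool :=
  if h : x - o < k then u ⟨x - o, h⟩ else false

/-- Moving by `i` symbols moves ranks by `2 * i`, which preserves parity and links. The bound on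
blocks keeps the default value of `extend` out of play. -/
theorem pattern_extend_mem {b : ℕ → Bool} {o k m g l : ℕ}
    (hb : ∀ r < m, o ≤ block (segment 0 g l r) ∧ block (segment 0 g l r) < o + k)
    {u : Fin k → Bool} (hu : u ∈ lateFactors b k) :
    pattern (extend o u) m (segment 0 g l) ∈ latePatterns b m := by
  intro N
  obtain ⟨i, hi, h⟩ := Filter.frequently_atTop.1 hu (N + o)
  refine ⟨segment (i - o) g l, segment_strictMono _ _ _, ?_, ?_⟩
  · unfold segment
    omega
  · have key : ∀ r < m, b (block (segment (i - o) g l r)) =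
        extend o u (block (segment 0 g l r)) := fun r hr => by
      obtain ⟨h1, h2⟩ := hb r hr
      rw [segment_eq, block_add _ (segment_pos _ _ _ _), extend, dif_pos (by omega), ← h]
      congr 1
      dsimp only
      omega
    funext r s
    refine propext (and_congr_right fun hrs => and_congr_right fun hs => ?_)
    unfold Linked
    rw [key r (by omega), key s hs, segment_eq (i - o) g l r, segment_eq (i - o) g l s]
    refine or_congr Iff.rfl (and_congr_right fun _ => and_congr (by omega) (or_congr ?_ ?_))
    · exact and_congr_left fun _ => by omega
    · omega

/-- The diagonal of the code spells out the word, as every letter is the side of some chosen point.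
-/
theorem pattern_extend_injective {o k m g l : ℕ}
    (hsurj : ∀ x, o ≤ x → x < o + k → ∃ r < m, block (segment 0 g l r) = x) :
    Function.Injective fun u : Fin k → Bool => pattern (extend o u) m (segment 0 g l) := by
  intro u v huv
  funext j
  obtain ⟨r, hr, hx⟩ := hsurj (o + j) (by omega) (by omega)
  have := congrFun (congrFun huv r) r
  simp only [pattern, le_refl, hr, hx, true_and, ne_eq, not_true_eq_false, false_and, or_false,
    eq_iff_iff] at this
  have he : ∀ w : Fin k → Bool, extend o w (o + j) = w j := fun w => by simp [extend]
  rw [he, he] at this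
  cases h1 : u j <;> cases h2 : v j <;> simp_all

/-- Only links of span 3 are used, since these hold whatever `b` is. -/
theorem indecomposable_pattern {m g l : ℕ} (b : ℕ → Bool)
    (h : ∀ t, 0 < t → t < m → ∃ r < t, ∃ s, t ≤ s ∧ s < m ∧ segment 0 g l r % 2 = 1 ∧
      segment 0 g l s = segment 0 g l r + 3) :
    Indecomposable m (pattern b m (segment 0 g l)) := by
  intro t h0 ht
  obtain ⟨r, hr, s, hs, hsm, h1, h2⟩ := h t h0 ht
  exact ⟨r, hr, s, hs, by omega, hsm, Or.inr ⟨by omega, h1, Or.inr h2⟩⟩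

/-- A shape of indecomposable codes of size `m`, determined by factors of length `k`. -/
structure IsShape (o k m g l : ℕ) : Prop where
  bound : ∀ r < m, o ≤ block (segment 0 g l r) ∧ block (segment 0 g l r) < o + k
  surj : ∀ x, o ≤ x → x < o + k → ∃ r < m, block (segment 0 g l r) = x
  cut : ∀ t, 0 < t → t < m → ∃ r < t, ∃ s, t ≤ s ∧ s < m ∧ segment 0 g l r % 2 = 1 ∧
      segment 0 g l s = segment 0 g l r + 3

/-- The codes of a given shape coming from a set of factors. -/
def shapeCodes (o m g l : ℕ) {k : ℕ} (U : Set (Fin k → Bool)) : Set (ℕ → ℕ → Prop) :=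
  (fun u => pattern (extend o u) m (segment 0 g l)) '' U

theorem IsShape.shapeCodes_subset {o k m g l : ℕ} (h : IsShape o k m g l) {b : ℕ → Bool}
    {U : Set (Fin k → Bool)} (hU : U ⊆ lateFactors b k) :
    shapeCodes o m g l U ⊆ lateIndecomposables b m := by
  rintro _ ⟨u, hu, rfl⟩
  exact ⟨pattern_extend_mem h.bound (hU hu), indecomposable_pattern _ h.cut⟩

theorem IsShape.ncard_shapeCodes {o k m g l : ℕ} (h : IsShape o k m g l)
    (U : Set (Fin k → Bool)) : (shapeCodes o m g l U).ncard = U.ncard :=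
  Set.ncard_image_of_injective _ (pattern_extend_injective h.surj)

/-! ### The four kinds of runs of consecutive pins. -/

/-- Here and below, the first word of the name is the parity of the index of the first point, the
second that of the number of points. -/
theorem isShape_even_odd (j : ℕ) : IsShape 1 (j + 1) (2 * j + 1) 1 (2 * j + 1) where
  bound r hr := by
    unfold segment block
    split_ifs <;> omega
  surj x h1 h2 := by
    refine ⟨2 * (x - 1) - 1, by omega, ?_⟩
    unfold segment block
    split_ifs <;> omega
  cut t h0 ht := by
    obtain ⟨k, rfl | rfl | rfl⟩ : ∃ k, t = 1 ∨ t = 2 * k + 2 ∨ t = 2 * k + 3 :=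
      ⟨(t - 2) / 2, by omega⟩
    · refine ⟨0, by omega, 2, by omega, by omega, ?_⟩
      unfold segment
      split_ifs <;> omega
    · rcases Nat.eq_zero_or_pos k with rfl | hk
      · refine ⟨0, by omega, 2, by omega, by omega, ?_⟩
        unfold segment
        split_ifs <;> omega
      · refine ⟨2 * k - 1, by omega, 2 * k + 2, by omega, by omega, ?_⟩
        unfold segment
        split_ifs <;> omega
    · refine ⟨2 * k + 1, by omega, 2 * k + 4, by omega, by omega, ?_⟩
      unfold segment
      split_ifs <;> omega

theorem isShape_even_even (j : ℕ) : IsShape 1 (j + 1) (2 * j + 2) 1 (2 * j + 1) where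
  bound r hr := by
    unfold segment block
    split_ifs <;> omega
  surj x h1 h2 := by
    refine ⟨2 * (x - 1) - 1, by omega, ?_⟩
    unfold segment block
    split_ifs <;> omega
  cut t h0 ht := by
    rcases Nat.eq_zero_or_pos j with rfl | hj
    · refine ⟨0, by omega, 1, by omega, by omega, ?_⟩
      unfold segment
      split_ifs <;> omega
    obtain ⟨k, rfl | rfl | rfl⟩ : ∃ k, t = 1 ∨ t = 2 * k + 2 ∨ t = 2 * k + 3 :=
      ⟨(t - 2) / 2, by omega⟩
    · refine ⟨0, by omega, 2, by omega, by omega, ?_⟩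
      unfold segment
      split_ifs <;> omega
    · rcases Nat.eq_zero_or_pos k with rfl | hk
      · refine ⟨0, by omega, 2, by omega, by omega, ?_⟩
        unfold segment
        split_ifs <;> omega
      · refine ⟨2 * k - 1, by omega, 2 * k + 2, by omega, by omega, ?_⟩
        unfold segment
        split_ifs <;> omega
    -- The last point comes after the second gap, so its position is one less than the general
    -- formula predicts.
    · by_cases hk : 2 * k + 3 = 2 * j + 1
      · refine ⟨2 * k + 1, by omega, 2 * k + 3, by omega, by omega, ?_⟩
        unfold segment
        split_ifs <;> omega
      · refine ⟨2 * k + 1, by omega, 2 * k + 4, by omega, by omega, ?_⟩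
        unfold segment
        split_ifs <;> omega

/-- For `j = 1` the ranks are 1 and 2, which are linked only if their sides agree; hence `2 ≤ j`. -/
theorem isShape_odd_even (j : ℕ) (hj : 2 ≤ j) : IsShape 0 (j + 1) (2 * j) (2 * j) (2 * j) where
  bound r hr := by
    unfold segment block
    split_ifs <;> omega
  surj x h1 h2 := by
    rcases Nat.eq_zero_or_pos x with rfl | hx
    · exact ⟨1, by omega, by unfold segment block; split_ifs <;> omega⟩
    · refine ⟨2 * (x - 1), by omega, ?_⟩
      unfold segment block
      split_ifs <;> omega
  cut t h0 ht := by
    obtain ⟨k, rfl | rfl⟩ : ∃ k, t = 2 * k + 1 ∨ t = 2 * k + 2 := ⟨(t - 1) / 2, by omega⟩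
    · by_cases hk : k + 1 = j
      · refine ⟨2 * k - 2, by omega, 2 * k + 1, by omega, by omega, ?_⟩
        unfold segment
        split_ifs <;> omega
      · refine ⟨2 * k, by omega, 2 * k + 3, by omega, by omega, ?_⟩
        unfold segment
        split_ifs <;> omega
    · refine ⟨2 * k, by omega, 2 * k + 3, by omega, by omega, ?_⟩
      unfold segment
      split_ifs <;> omega

theorem isShape_odd_odd (j : ℕ) (hj : 1 ≤ j) :
    IsShape 0 (j + 1) (2 * j + 1) (2 * j + 1) (2 * j) where
  bound r hr := by
    unfold segment block
    split_ifs <;> omega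
  surj x h1 h2 := by
    rcases Nat.eq_zero_or_pos x with rfl | hx
    · exact ⟨1, by omega, by unfold segment block; split_ifs <;> omega⟩
    · refine ⟨2 * (x - 1), by omega, ?_⟩
      unfold segment block
      split_ifs <;> omega
  cut t h0 ht := by
    obtain ⟨k, rfl | rfl⟩ : ∃ k, t = 2 * k + 1 ∨ t = 2 * k + 2 := ⟨(t - 1) / 2, by omega⟩
    · by_cases hk : k + 1 = j
      · refine ⟨2 * k, by omega, 2 * k + 2, by omega, by omega, ?_⟩
        unfold segment
        split_ifs <;> omega
      · refine ⟨2 * k, by omega, 2 * k + 3, by omega, by omega, ?_⟩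
        unfold segment
        split_ifs <;> omega
    · by_cases hk : k + 1 = j
      · refine ⟨2 * k, by omega, 2 * k + 2, by omega, by omega, ?_⟩
        unfold segment
        split_ifs <;> omega
      · refine ⟨2 * k, by omega, 2 * k + 3, by omega, by omega, ?_⟩
        unfold segment
        split_ifs <;> omega

/-! ### Counting indecomposable codes. -/

theorem add_le_ncard_lateIndecomposables {b : ℕ → Bool} {m o k g l o' k' g' l' : ℕ}
    (h : IsShape o k m g l) (h' : IsShape o' k' m g' l')
    {U : Set (Fin k → Bool)} {U' : Set (Fin k' → Bool)}
    (hU : U ⊆ lateFactors b k) (hU' : U' ⊆ lateFactors b k') {r s : ℕ} (hrs : r < s)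
    (hn : ∀ u ∈ U, ¬ Linked (extend o u) (segment 0 g l r) (segment 0 g l s)) (hs : s < m)
    (hn' : ∀ u ∈ U', Linked (extend o' u) (segment 0 g' l' r) (segment 0 g' l' s)) :
    U.ncard + U'.ncard ≤ (lateIndecomposables b m).ncard := by
  -- The entry `(r, s)` alone tells the two shapes apart.
  have hd : Disjoint (shapeCodes o m g l U) (shapeCodes o' m g' l' U') := by
    rw [Set.disjoint_left]
    rintro _ ⟨u, hu, rfl⟩ ⟨v, hv, huv⟩
    have := congrFun (congrFun huv r) s
    simp only [pattern, hrs.le, hs, hrs.ne, hn u hu, hn' v hv] at this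
    simp at this
    exact hrs.ne this
  have hf : (shapeCodes o m g l U).Finite := (Set.toFinite U).image _
  have hf' : (shapeCodes o' m g' l' U').Finite := (Set.toFinite U').image _
  rw [← h.ncard_shapeCodes U, ← h'.ncard_shapeCodes U', ← Set.ncard_union_eq hd hf hf']
  exact Set.ncard_le_ncard (Set.union_subset (h.shapeCodes_subset hU)
    (h'.shapeCodes_subset hU')) (finite_lateIndecomposables b m)

/-- Otherwise only 01 and 10 could recur, but at least three factors of length 2 do. -/
theorem exists_eq_mem_lateFactors {b : ℕ → Bool} (hb : ¬ EventuallyPeriodic b) :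
    ∃ u ∈ lateFactors b 2, u 0 = u 1 := by
  by_contra! h
  have h1 := lt_ncard_lateFactors hb 2
  have h2 : lateFactors b 2 ⊆ {![false, true], ![true, false]} := by
    intro u hu
    have := h u hu
    cases h3 : u 0 <;> cases h4 : u 1 <;> simp_all
    · left; funext j; fin_cases j <;> simp [h3, h4]
    · right; funext j; fin_cases j <;> simp [h3, h4]
  have h3 := (Set.ncard_le_ncard h2).trans ((Set.ncard_insert_le _ _).trans_eq
    (congrArg (· + 1) (Set.ncard_singleton _)))
  omega

theorem indecomposableBound_le {b : ℕ → Bool} (hb : ¬ EventuallyPeriodic b) {m : ℕ} (hm : 0 < m) :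
    indecomposableBound m ≤ (lateIndecomposables b m).ncard := by
  unfold indecomposableBound
  have hF := lt_ncard_lateFactors hb
  have single : ∀ {o k g l : ℕ}, IsShape o k m g l → k < (lateIndecomposables b m).ncard :=
    fun {o k g l} h => by
      have := Set.ncard_le_ncard (h.shapeCodes_subset (Set.Subset.refl (lateFactors b k)))
        (finite_lateIndecomposables b m)
      rw [h.ncard_shapeCodes] at this
      exact (hF k).trans_le this
  split_ifs with h1 h2 h3
  · subst h1
    exact single (isShape_even_odd 0)
  · subst h2
    exact single (isShape_even_even 0)
  · subst h3
    -- With unequal letters the odd run of size 3 can repeat a code of the even run, so only one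
    -- code, with equal letters, is added: 3 + 1.
    obtain ⟨u, hu, huu⟩ := exists_eq_mem_lateFactors hb
    have := add_le_ncard_lateIndecomposables (isShape_even_odd 1) (isShape_odd_odd 1 le_rfl)
      (Set.Subset.refl (lateFactors b 2)) (Set.singleton_subset_iff.2 hu) (r := 0) (s := 1)
      (by omega) (fun u _ => by simp [Linked, segment]) (by omega)
      (fun v hv => by
        rw [Set.mem_singleton_iff] at hv
        subst hv
        simp [Linked, segment, block, extend, huu])
    rw [Set.ncard_singleton] at this
    exact (Nat.succ_le_succ (hF 2)).trans this
  · obtain ⟨j, rfl | rfl⟩ := Nat.even_or_odd' m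
    · obtain ⟨i, rfl⟩ : ∃ i, j = i + 2 := ⟨j - 2, by omega⟩
      -- Positions 0 and 3 have ranks 1 and 4, linked, in the odd run, but ranks 1 and 5 or 6,
      -- unlinked, in the even one. The factors have lengths `i + 2` and `i + 3`, giving `(i + 3) +
      -- (i + 4) = m + 3`.
      have := add_le_ncard_lateIndecomposables (isShape_even_even (i + 1))
        (isShape_odd_even (i + 2) (by omega))
        (Set.Subset.refl (lateFactors b _)) (Set.Subset.refl (lateFactors b _)) (r := 0) (s := 3)
        (by omega) (fun u _ => by unfold Linked segment; split_ifs <;> omega) (by omega)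
        (fun u _ => by unfold Linked segment; split_ifs <;> omega)
      have := hF (i + 1 + 1)
      have := hF (i + 2 + 1)
      rw [show 2 * (i + 1) + 2 = 2 * (i + 2) by ring] at *
      omega
    · obtain ⟨i, rfl⟩ : ∃ i, j = i + 2 := ⟨j - 2, by omega⟩
      have := add_le_ncard_lateIndecomposables (isShape_even_odd (i + 2))
        (isShape_odd_odd (i + 2) (by omega))
        (Set.Subset.refl (lateFactors b _)) (Set.Subset.refl (lateFactors b _)) (r := 0) (s := 3)
        (by omega) (fun u _ => by unfold Linked segment; split_ifs <;> omega) (by omega)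
        (fun u _ => by unfold Linked segment; split_ifs <;> omega)
      have := hF (i + 2 + 1)
      omega

end PinClass
namespace PinClass

/-! ### Conclusion. -/

theorem latePatterns_zero_ncard_pos (b : ℕ → Bool) : 0 < (latePatterns b 0).ncard := by
  rw [Set.ncard_pos (finite_latePatterns b 0)]
  refine ⟨fun _ _ => False, fun N => ⟨fun r => N + r, fun r s h => by dsimp only; omega,
    by simp, ?_⟩⟩
  funext r s
  simp [pattern]

end PinClass

theorem lemma6p1 (b : ℕ → Bool)
    (h : PinClass.lowerGrowthRate (fun n : ℕ => (PinClass.pinClass (PinClass.phi b) n).ncard)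
      < ENNReal.ofReal PinClass.mu) :
    PinClass.EventuallyPeriodic b := by
  by_contra hb
  exact absurd h (not_lt.2 (PinClass.mu_le_lowerGrowthRate (PinClass.ncard_latePatterns_le b)
    (PinClass.latePatterns_zero_ncard_pos b) (fun _ hm => PinClass.indecomposableBound_le hb hm)
    (PinClass.sum_ncard_le b)))
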